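/- Let $G$ be a finite abelian group and $A$ a finite set of size $q\ge 2$. The group $G$ acts on the set $A^G$ of all functions $x:G\to A$ by $(x\cdot g)(h)=x(hg^{-1})$. A cellular automaton over $G$ and $A$ is a map $\tau:A^G\to A^G$ for which there are a finite set $S\subseteq G$ and a function $\mu:A^S\to A$ such that $\tau(x)(g)=\mu\big((x(sg))_{s\in S}\big)$ for all $x\in A^G$ and $g\in G$. Let $\mathrm{CA}(G;A)$ be the finite monoid, under composition, of all cellular automata over $G$ and $A$, and let $\mathrm{ICA}(G;A)$ be its group of invertible elements. For a subset $U$ of a finite monoid $M$, the relative rank $\mathrm{Rank}(M:U)$ is the minimum cardinality of a subset $V\subseteq M$ such that $U\cup V$ generates $M$. Write $[H]$ for the conjugacy class of a subgroup $H\le G$, and $[H]\le[K]$ if $H\le g^{-1}Kg$ for some $g\in G$. Let $\mathcal E_G$ be the set of all ordered pairs $([H],[K])$ with $[H]\le[K]$, including the pairs $([H],[H])$; as $G$ is abelian, this amounts to the set of pairs of subgroups $(H,K)$ with $H\le K$. Let $H_1,\dots,H_r$ be the list of the different subgroups of $G$, with $H_1=G$, and let $\alpha_i$ be the number of $G$-orbits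 on $A^G$ all of whose elements have stabiliser in $[H_i]=\{H_i\}$. Then $$\mathrm{Rank}\big(\mathrm{CA}(G;A):\mathrm{ICA}(G;A)\big)=|\mathcal E_G|-\sum_{i=2}^r\delta(\alpha_i,1),$$ where $\delta$ is Kronecker's delta. -/

import Mathlib

namespace CellAut

/-- `τ : A^G → A^G` is a cellular automaton: there are a finite memory set `S ⊆ G` and a local
function `μ : A^S → A` with `τ(x)(g) = μ((s ↦ x(s g))|_S)` for all `x ∈ A^G` and `g ∈ G`. -/
def IsCA {G A : Type*} [Group G] (τ : (G → A) → (G → A)) : Prop :=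
  ∃ (S : Finset G) (μ : (S → A) → A), ∀ (x : G → A) (g : G), τ x g = μ (fun s => x (s.1 * g))

theorem IsCA.id {G A : Type*} [Group G] : IsCA (fun x : G → A => x) :=
  ⟨{1}, fun y => y ⟨1, Finset.mem_singleton_self 1⟩, fun x g => by simp⟩

theorem IsCA.comp {G A : Type*} [Group G] {σ τ : (G → A) → (G → A)}
    (hσ : IsCA σ) (hτ : IsCA τ) : IsCA (fun x => σ (τ x)) := by
  classical
  obtain ⟨T, ν, hν⟩ := hσ
  obtain ⟨S, μ, hμ⟩ := hτ
  refine ⟨Finset.image₂ (fun s t => s * t) S T,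
    fun y => ν fun t => μ fun s => y ⟨s.1 * t.1, Finset.mem_image₂_of_mem s.2 t.2⟩, ?_⟩
  intro x g
  simp only [hν, hμ, mul_assoc]

/-- The monoid `CA(G;A)` of all cellular automata over `G` and `A`, under composition. -/
def CA (G A : Type*) [Group G] : Submonoid (Function.End (G → A)) where
  carrier := {τ | IsCA τ}
  one_mem' := IsCA.id
  mul_mem' {σ τ} hσ hτ := by
    have h1 : IsCA σ := hσ
    have h2 : IsCA τ := hτ
    have h3 := IsCA.comp h1 h2
    exact h3

instance instFiniteCA (G A : Type*) [Group G] [Finite G] [Finite A] : Finite (CA G A) :=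
  have : Finite (Function.End (G → A)) := inferInstanceAs (Finite ((G → A) → (G → A)))
  inferInstance

/-- The set `ICA(G;A)` of invertible cellular automata, as a subset of `CA(G;A)`. -/
def ICA (G A : Type*) [Group G] : Set (CA G A) :=
  {τ | ∃ φ : CA G A, τ * φ = 1 ∧ φ * τ = 1}

/-- The relative rank of a subset `U` of a finite monoid `M`: the minimum cardinality of a subset
`V ⊆ M` such that `U ∪ V` generates `M`. -/
noncomputable def relativeRank {M : Type*} [Monoid M] [Finite M] (U : Set M) : ℕ :=
  sInf {k | ∃ V : Set M, V.ncard = k ∧ Submonoid.closure (U ∪ V) = ⊤}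

/-- The infimum in the definition of the relative rank is a minimum. -/
theorem relativeRank_isLeast {M : Type*} [Monoid M] [Finite M] (U : Set M) :
    IsLeast {k | ∃ V : Set M, V.ncard = k ∧ Submonoid.closure (U ∪ V) = ⊤} (relativeRank U) :=
  ⟨Nat.sInf_mem ⟨_, Set.univ, rfl, by simp⟩, fun _ hk => Nat.sInf_le hk⟩

/-- The right action of `G` on configurations: `(x · g)(h) = x(h g⁻¹)`. -/
def shift {G A : Type*} [Group G] (x : G → A) (g : G) : G → A := fun h => x (h * g⁻¹)

theorem shift_one {G A : Type*} [Group G] (x : G → A) : shift x 1 = x := by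
  funext h; simp [shift]

theorem shift_mul {G A : Type*} [Group G] (x : G → A) (g k : G) :
    shift x (g * k) = shift (shift x g) k := by
  funext h; simp [shift, mul_assoc]

/-- The `G`-orbit `xG` of a configuration. -/
def orbit {G A : Type*} [Group G] (x : G → A) : Set (G → A) := {y | ∃ g : G, y = shift x g}

/-- The set of all `G`-orbits on `A^G`. -/
def orbits (G A : Type*) [Group G] : Set (Set (G → A)) := {O | ∃ x : G → A, O = orbit x}

/-- The stabiliser `G_x = {g : x · g = x}`. -/
def stabiliser {G A : Type*} [Group G] (x : G → A) : Subgroup G where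
  carrier := {g | shift x g = x}
  one_mem' := shift_one x
  mul_mem' {a b} ha hb := by
    change shift x a = x at ha
    change shift x b = x at hb
    change shift x (a * b) = x
    rw [shift_mul, ha, hb]
  inv_mem' {a} ha := by
    change shift x a = x at ha
    change shift x a⁻¹ = x
    conv_lhs => rw [← ha]
    rw [← shift_mul, mul_inv_cancel, shift_one]

/-- The conjugate subgroup `g⁻¹ H g`. -/
def conjBy {G : Type*} [Group G] (H : Subgroup G) (g : G) : Subgroup G :=
  H.map (MulAut.conj g⁻¹).toMonoidHom

theorem mem_conjBy {G : Type*} [Group G] {H : Subgroup G} {g k : G} :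
    k ∈ conjBy H g ↔ g * k * g⁻¹ ∈ H := by
  constructor
  · rintro ⟨h, hh, rfl⟩
    simpa [mul_assoc] using hh
  · intro h
    exact ⟨_, h, by simp [mul_assoc]⟩

/-- Conjugacy of subgroups of `G`: `H ∼ K` if `g⁻¹ H g = K` for some `g`. -/
def conjSetoid (G : Type*) [Group G] : Setoid (Subgroup G) where
  r H K := ∃ g : G, conjBy H g = K
  iseqv :=
    { refl := fun H => ⟨1, by ext k; simp [mem_conjBy]⟩
      symm := by
        rintro H K ⟨g, rfl⟩
        exact ⟨g⁻¹, by ext k; simp [mem_conjBy, mul_assoc]⟩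
      trans := by
        rintro H K L ⟨g, rfl⟩ ⟨k, rfl⟩
        exact ⟨g * k, by ext l; simp [mem_conjBy, mul_assoc]⟩ }

/-- The set of conjugacy classes of subgroups of `G`. -/
def ConjClass (G : Type*) [Group G] : Type _ := Quotient (conjSetoid G)

/-- The conjugacy class `[H]`. -/
def conjClass {G : Type*} [Group G] (H : Subgroup G) : ConjClass G := Quotient.mk (conjSetoid G) H

/-- The relation `[H] ≤ [K]` on conjugacy classes: `H ≤ g⁻¹ K g` for some `g ∈ G`. -/
def ConjClass.IsBelow {G : Type*} [Group G] (c d : ConjClass G) : Prop :=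
  ∃ H K : Subgroup G, conjClass H = c ∧ conjClass K = d ∧ ∃ g : G, H ≤ conjBy K g

/-- The edge set of the graph of conjugacy classes of subgroups: all ordered pairs
`([H], [K])` with `[H] ≤ [K]` (loops included). -/
def edges (G : Type*) [Group G] : Set (ConjClass G × ConjClass G) := {p | p.1.IsBelow p.2}

/-- `B_{[H]}`: the configurations whose stabiliser lies in the conjugacy class of `H`. -/
def box {G : Type*} [Group G] (H : Subgroup G) (A : Type*) : Set (G → A) :=
  {x | conjClass (stabiliser x) = conjClass H}

/-- `α_{[H]}(G;A)`: the number of `G`-orbits on `A^G` contained in `B_{[H]}`. -/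
noncomputable def alpha {G : Type*} [Group G] (H : Subgroup G) (A : Type*) : ℕ :=
  {O : Set (G → A) | O ∈ orbits G A ∧ O ⊆ box H A}.ncard

/-- Kronecker's delta. -/
def kronecker (a b : ℕ) : ℕ := if a = b then 1 else 0

end CellAut

/-!
Over a finite group the cellular automata are exactly the equivariant self-maps of `A^G`, so let an
abelian group act on a finite set `X`. The collapses, which move one orbit onto a different one and
fix everything else, generate the equivariant self-maps of `X` together with the units: an
equivariant map that is not a unit misses a point `w`, and moving a suitable orbit to that of `w`
factors it through a map closer to being a unit. Conjugating by units shows that one collapse for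
each pair of stabilisers `H ≤ K` is enough.

One for each pair is also necessary. When a collapse is written as a product of generators, the
first nonunit to be applied acts after units only. Up to a unit, the pairs of orbits it identifies
are identified by the collapse as well; hence it determines the pair `{H, K}`, and so `(H, K)`.

For `A^G` every subgroup is a stabiliser, so all pairs `H ≤ K` occur except those `(H, H)` for which
a single orbit has stabiliser `H`.
-/

namespace EquivariantEnd

open MulAction
open CellAut (relativeRank relativeRank_isLeast)

attribute [local instance] MulActionHom.End.instMonoidId

section Monoid

variable {M N : Type*} [Monoid M] [Monoid N]

theorem isUnit_or_exists_eq_mul_mul_of_mem_closure {V : Set M} {m : M}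
    (hm : m ∈ Submonoid.closure ({u | IsUnit u} ∪ V)) :
    IsUnit m ∨ ∃ a, ∃ v ∈ V, ∃ u, ¬IsUnit v ∧ IsUnit u ∧ m = a * v * u := by
  induction hm using Submonoid.closure_induction_left with
  | one => exact .inl isUnit_one
  | mul_left s hs m _ ih =>
    obtain hm | ⟨a, v, hv, u, hv', hu, rfl⟩ := ih
    · by_cases hs' : IsUnit s
      · exact .inl (hs'.mul hm)
      · exact .inr ⟨1, s, hs.resolve_left hs', m, hs', hm, by rw [one_mul]⟩
    · exact .inr ⟨s * a, v, hv, u, hv', hu, by simp only [mul_assoc]⟩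

theorem exists_ncard_eq_closure_image_union_eq_top (e : M ≃* N) {U V : Set M}
    (hV : Submonoid.closure (U ∪ V) = ⊤) :
    ∃ W : Set N, W.ncard = V.ncard ∧ Submonoid.closure (e '' U ∪ W) = ⊤ := by
  refine ⟨e '' V, Set.ncard_image_of_injective V e.injective, ?_⟩
  rw [← Set.image_union, ← MonoidHom.map_mclosure, hV]
  exact Submonoid.map_equiv_top e

theorem relativeRank_image_mulEquiv [Finite M] [Finite N] (e : M ≃* N) (U : Set M) :
    relativeRank (e '' U) = relativeRank U := by
  refine congrArg sInf (Set.ext fun k => ⟨?_, ?_⟩)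
  · rintro ⟨W, rfl, hW⟩
    obtain ⟨V, hVW, hV⟩ := exists_ncard_eq_closure_image_union_eq_top e.symm hW
    exact ⟨V, hVW, by simpa only [Set.image_image, e.symm_apply_apply, Set.image_id'] using hV⟩
  · rintro ⟨V, rfl, hV⟩
    exact exists_ncard_eq_closure_image_union_eq_top e hV

end Monoid

section Group

variable {G X Y : Type*} [Group G] [MulAction G X] [MulAction G Y]

instance [Finite X] : Finite (X →[G] X) := DFunLike.finite _

theorem smul_mem_orbit_iff {x y : X} {g : G} : g • y ∈ orbit G x ↔ y ∈ orbit G x := by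
  rw [← orbit_eq_iff, orbit_smul, orbit_eq_iff]

theorem stabilizer_le_stabilizer_apply (f : X →[G] Y) (x : X) :
    stabilizer G x ≤ stabilizer G (f x) := fun g hg => by
  rw [mem_stabilizer_iff, ← map_smul, hg]

theorem stabilizer_apply_of_injective {f : X →[G] Y} (hf : Function.Injective f) (x : X) :
    stabilizer G (f x) = stabilizer G x :=
  le_antisymm (fun g hg => hf (by rw [map_smul, hg])) (stabilizer_le_stabilizer_apply f x)

theorem apply_mem_orbit (f : X →[G] Y) {x y : X} (h : y ∈ orbit G x) :
    f y ∈ orbit G (f x) := by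
  obtain ⟨g, rfl⟩ := h
  exact ⟨g, (map_smul f g x).symm⟩

theorem apply_mem_orbit_iff {f : X →[G] Y} (hf : Function.Injective f) {x y : X} :
    f y ∈ orbit G (f x) ↔ y ∈ orbit G x := by
  refine ⟨?_, apply_mem_orbit f⟩
  rintro ⟨g, hg⟩
  exact ⟨g, hf ((map_smul f g x).trans hg)⟩

theorem eq_of_apply_eq_of_mem_orbit {f : X →[G] Y} {x y : X}
    (hx : stabilizer G (f x) = stabilizer G x) (hy : y ∈ orbit G x) (h : f y = f x) : y = x := by
  obtain ⟨g, rfl⟩ := hy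
  change g ∈ stabilizer G x
  rwa [← hx, mem_stabilizer_iff, ← map_smul]

theorem isUnit_iff_bijective {f : X →[G] X} : IsUnit f ↔ Function.Bijective f := by
  refine ⟨?_, fun hf => ?_⟩
  · rintro ⟨u, rfl⟩
    exact Function.bijective_iff_has_inverse.2 ⟨u.inv,
      fun x => DFunLike.congr_fun u.inv_val x, fun x => DFunLike.congr_fun u.val_inv x⟩
  · obtain ⟨g, hl, hr⟩ := Function.bijective_iff_has_inverse.1 hf
    exact ⟨⟨f, f.inverse g hl hr, MulActionHom.ext hr, MulActionHom.ext hl⟩, rfl⟩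

theorem isUnit_iff_injective [Finite X] {f : X →[G] X} : IsUnit f ↔ Function.Injective f :=
  isUnit_iff_bijective.trans Finite.injective_iff_bijective.symm

theorem isUnit_iff_surjective [Finite X] {f : X →[G] X} : IsUnit f ↔ Function.Surjective f :=
  isUnit_iff_bijective.trans Finite.surjective_iff_bijective.symm

theorem smul_eq_smul_of_stabilizer_le {x : X} {w : Y} (h : stabilizer G x ≤ stabilizer G w)
    {g k : G} (hgk : g • x = k • x) : g • w = k • w := by
  have hmem : k⁻¹ * g ∈ stabilizer G x := by
    rw [mem_stabilizer_iff, mul_smul, hgk, inv_smul_smul]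
  rw [← inv_smul_eq_iff, ← mul_smul]
  exact h hmem

open Classical in
/-- The equivariant map sending `g • x` to `g • w` for all `g`, and agreeing with `f` off the orbit
of `x`: the equivariant counterpart of `Function.update`. -/
noncomputable def updateOrbit (f : X →[G] Y) (x : X) (w : Y)
    (h : stabilizer G x ≤ stabilizer G w) : X →[G] Y where
  toFun y := if hy : y ∈ orbit G x then hy.choose • w else f y
  map_smul' g y := by
    by_cases hy : y ∈ orbit G x
    · have hgy : g • y ∈ orbit G x := smul_mem_orbit_iff.2 hy
      have hchoose : hgy.choose • x = (g * hy.choose) • x :=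
        hgy.choose_spec.trans (by rw [mul_smul]; exact congrArg (g • ·) hy.choose_spec.symm)
      rw [dif_pos hy, dif_pos hgy, smul_eq_smul_of_stabilizer_le h hchoose, mul_smul, id]
    · rw [dif_neg hy, dif_neg (mt smul_mem_orbit_iff.1 hy), map_smul, id]

theorem updateOrbit_of_notMem {f : X →[G] Y} {x : X} {w : Y}
    {h : stabilizer G x ≤ stabilizer G w} {y : X} (hy : y ∉ orbit G x) :
    updateOrbit f x w h y = f y :=
  dif_neg hy

theorem updateOrbit_self {f : X →[G] Y} {x : X} {w : Y} {h : stabilizer G x ≤ stabilizer G w} :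
    updateOrbit f x w h x = w := by
  have hx : x ∈ orbit G x := mem_orbit_self x
  have hchoose : hx.choose • x = (1 : G) • x := hx.choose_spec.trans (one_smul G x).symm
  exact (dif_pos hx).trans ((smul_eq_smul_of_stabilizer_le h hchoose).trans (one_smul G w))

/-- The equivariant map that moves the orbit of `x` onto the orbit of `y`, sending `x` to `y`, and
fixes all other points. -/
noncomputable def collapse (x y : X) (h : stabilizer G x ≤ stabilizer G y) : X →[G] X :=
  updateOrbit (.id G) x y h

theorem collapse_of_notMem {x y : X} {h : stabilizer G x ≤ stabilizer G y} {z : X}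
    (hz : z ∉ orbit G x) : collapse x y h z = z :=
  updateOrbit_of_notMem hz

theorem collapse_self {x y : X} {h : stabilizer G x ≤ stabilizer G y} : collapse x y h x = y :=
  updateOrbit_self

theorem mul_collapse {f : X →[G] X} (hf : Function.Injective f) {x y : X}
    (h : stabilizer G x ≤ stabilizer G y) (h' : stabilizer G (f x) ≤ stabilizer G (f y)) :
    f * collapse x y h = collapse (f x) (f y) h' * f := by
  ext z
  change f (collapse x y h z) = collapse (f x) (f y) h' (f z)
  by_cases hz : z ∈ orbit G x
  · obtain ⟨g, rfl⟩ := hz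
    simp only [map_smul, collapse_self]
  · rw [collapse_of_notMem hz, collapse_of_notMem (mt (apply_mem_orbit_iff hf).1 hz)]

theorem eq_collapse_mul_updateOrbit {f : X →[G] X} {w : X} (hw : w ∉ Set.range f) {x : X}
    (hxw : stabilizer G x ≤ stabilizer G w) (hwx : stabilizer G w ≤ stabilizer G (f x)) :
    f = collapse w (f x) hwx * updateOrbit f x w hxw := by
  ext y
  change f y = collapse w (f x) hwx (updateOrbit f x w hxw y)
  by_cases hy : y ∈ orbit G x
  · obtain ⟨g, rfl⟩ := hy
    simp only [map_smul, updateOrbit_self, collapse_self]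
  · have hfy : f y ∉ orbit G w := by
      rw [mem_orbit_symm]
      rintro ⟨g, hg⟩
      exact hw ⟨g • y, (map_smul f g y).trans hg⟩
    rw [updateOrbit_of_notMem hy, collapse_of_notMem hfy]

/-- The equivariant map exchanging the orbits of `x` and `y` along `g • x ↔ g • y`. If `x` and `y`
lie in one orbit, it permutes that orbit, sending `y` to `x`. -/
noncomputable def swapOrbits (x y : X) (h : stabilizer G x = stabilizer G y) : X →[G] X :=
  updateOrbit (collapse x y h.le) y x h.ge

theorem swapOrbits_right {x y : X} {h : stabilizer G x = stabilizer G y} :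
    swapOrbits x y h y = x :=
  updateOrbit_self

theorem swapOrbits_left {x y : X} {h : stabilizer G x = stabilizer G y} (hxy : x ∉ orbit G y) :
    swapOrbits x y h x = y :=
  (updateOrbit_of_notMem hxy).trans collapse_self

theorem swapOrbits_of_notMem {x y z : X} {h : stabilizer G x = stabilizer G y}
    (hx : z ∉ orbit G x) (hy : z ∉ orbit G y) : swapOrbits x y h z = z :=
  (updateOrbit_of_notMem hy).trans (collapse_of_notMem hx)

theorem isUnit_swapOrbits [Finite X] {x y : X} {h : stabilizer G x = stabilizer G y} :
    IsUnit (swapOrbits x y h) := by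
  refine isUnit_iff_surjective.2 fun z => ?_
  by_cases hx : z ∈ orbit G x
  · obtain ⟨g, rfl⟩ := hx
    exact ⟨g • y, by rw [map_smul, swapOrbits_right]⟩
  by_cases hy : z ∈ orbit G y
  · have hxy : x ∉ orbit G y := fun hxy => hx (orbit_eq_iff.2 hxy ▸ hy)
    obtain ⟨g, rfl⟩ := hy
    exact ⟨g • x, by rw [map_smul, swapOrbits_left hxy]⟩
  · exact ⟨z, swapOrbits_of_notMem hx hy⟩

theorem exists_isUnit_apply_eq_apply_eq [Finite X] {x y x' y' : X}
    (hx : stabilizer G x = stabilizer G x') (hy : stabilizer G y = stabilizer G y')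
    (h : y ∉ orbit G x) (h' : y' ∉ orbit G x') :
    ∃ u : X →[G] X, IsUnit u ∧ u x = x' ∧ u y = y' := by
  set s := swapOrbits x' x hx.symm
  have hs : Function.Injective s := isUnit_iff_injective.1 isUnit_swapOrbits
  have hsx : s x = x' := swapOrbits_right
  set t := swapOrbits y' (s y) (hy.symm.trans (stabilizer_apply_of_injective hs y).symm)
  have hty : t (s y) = y' := swapOrbits_right
  refine ⟨t * s, isUnit_swapOrbits.mul isUnit_swapOrbits, ?_, hty⟩
  change t (s x) = x'
  rw [hsx]
  refine swapOrbits_of_notMem (mt mem_orbit_symm.1 h') (mt mem_orbit_symm.1 ?_)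
  rwa [← hsx, apply_mem_orbit_iff hs]

theorem collapse_mem_of_stabilizer_eq [Finite X] {S : Submonoid (X →[G] X)}
    (hS : ∀ u, IsUnit u → u ∈ S) {x y x' y' : X} (hx : stabilizer G x = stabilizer G x')
    (hy : stabilizer G y = stabilizer G y') (hyx : y ∉ orbit G x) (hyx' : y' ∉ orbit G x')
    {h : stabilizer G x ≤ stabilizer G y} {h' : stabilizer G x' ≤ stabilizer G y'}
    (hmem : collapse x' y' h' ∈ S) : collapse x y h ∈ S := by
  obtain ⟨u, hu, rfl, rfl⟩ := exists_isUnit_apply_eq_apply_eq hx hy hyx hyx'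
  have hconj := mul_collapse (isUnit_iff_injective.1 hu) h h'
  obtain ⟨u, rfl⟩ := hu
  rw [← Units.eq_inv_mul_iff_mul_eq] at hconj
  rw [hconj]
  exact S.mul_mem (hS _ u⁻¹.isUnit) (S.mul_mem hmem (hS _ u.isUnit))

/-- The points with a preimage under `f` that has the same stabiliser. This set measures the
progress of the factorisation into collapses: it is everything precisely when `f` is a unit. -/
def regularImage (f : X →[G] X) : Set X :=
  {y | ∃ x, stabilizer G x = stabilizer G y ∧ f x = y}

/-- By minimality `f` permutes the finitely many points with stabiliser smaller than that of `w`, so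
none of them maps to `w`; but a preimage of `w`, which is not regular, would be such a point. -/
theorem notMem_range_of_minimalFor [Finite X] {f : X →[G] X} {w : X}
    (hw : MinimalFor (· ∈ (regularImage f)ᶜ) (stabilizer G) w) : w ∉ Set.range f := by
  rintro ⟨x, rfl⟩
  let D : Set X := {y | stabilizer G y < stabilizer G (f x)}
  have hD : D ⊆ f '' D := fun y hy => by
    by_contra hyD
    refine hw.not_prop_of_lt hy fun hreg => hyD ?_
    obtain ⟨z, hz, rfl⟩ := hreg
    exact ⟨z, hz.trans_lt hy, rfl⟩
  have hxD : x ∈ D := lt_of_le_of_ne (stabilizer_le_stabilizer_apply f x)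
    fun h => hw.prop ⟨x, h, rfl⟩
  have himage : D = f '' D := Set.eq_of_subset_of_ncard_le hD (Set.ncard_image_le D.toFinite)
  exact lt_irrefl (stabilizer G (f x)) (himage ▸ Set.mem_image_of_mem f hxD : f x ∈ D)

/-- Otherwise `f` would permute the points whose stabiliser is that of `w`. -/
theorem exists_stabilizer_eq_of_notMem_range [Finite X] {f : X →[G] X} {w : X}
    (hw : w ∉ Set.range f) :
    ∃ x, stabilizer G x = stabilizer G w ∧ (stabilizer G (f x) = stabilizer G x →
      ∃ z, z ∉ orbit G x ∧ stabilizer G z = stabilizer G x ∧ f z = f x) := by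
  by_contra! hcon
  let T : Set X := {x | stabilizer G x = stabilizer G w}
  have hmaps : Set.MapsTo f T T := fun x hx => (hcon x hx).1.trans hx
  have hinj : Set.InjOn f T := fun z hz x hx hzx => by
    refine eq_of_apply_eq_of_mem_orbit (hcon x hx).1 ?_ hzx
    by_contra hzx'
    exact (hcon x hx).2 z hzx' (Eq.trans hz (Eq.symm hx)) hzx
  obtain ⟨x, -, hx⟩ := ((T.toFinite.injOn_iff_bijOn_of_mapsTo hmaps).1 hinj).surjOn
    (rfl : stabilizer G w = stabilizer G w)
  exact hw ⟨x, hx⟩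

theorem stabilizer_smul_eq_stabilizer_smul_iff {x y : X} {g : G} :
    stabilizer G (g • x) = stabilizer G (g • y) ↔ stabilizer G x = stabilizer G y := by
  simp only [stabilizer_smul_eq_stabilizer_map_conj]
  exact (Subgroup.map_injective (MulAut.conj g).injective).eq_iff

/-- If `f x` was regular through `x`, it stays so through the point `z`. -/
theorem regularImage_ssubset_regularImage_updateOrbit {f : X →[G] X} {x w : X}
    (hw : w ∉ Set.range f) (hxw : stabilizer G x = stabilizer G w)
    (hx : stabilizer G (f x) = stabilizer G x →
      ∃ z, z ∉ orbit G x ∧ stabilizer G z = stabilizer G x ∧ f z = f x) :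
    regularImage f ⊂ regularImage (updateOrbit f x w hxw.le) := by
  refine (Set.ssubset_iff_of_subset ?_).2
    ⟨w, ⟨x, hxw, updateOrbit_self⟩, fun ⟨y, _, hy⟩ => hw ⟨y, hy⟩⟩
  rintro _ ⟨y, hy, rfl⟩
  by_cases hyx : y ∈ orbit G x
  · obtain ⟨g, rfl⟩ := hyx
    simp only [map_smul, stabilizer_smul_eq_stabilizer_smul_iff] at hy ⊢
    obtain ⟨z, hz, hzx, hfz⟩ := hx hy.symm
    refine ⟨g • z, stabilizer_smul_eq_stabilizer_smul_iff.2 (hzx.trans hy), ?_⟩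
    rw [map_smul, updateOrbit_of_notMem hz, hfz]
  · exact ⟨y, hy, updateOrbit_of_notMem hyx⟩

theorem exists_eq_collapse_mul_of_not_isUnit [Finite X] {f : X →[G] X} (hf : ¬IsUnit f) :
    ∃ (f' : X →[G] X) (x y : X) (h : stabilizer G x ≤ stabilizer G y),
      regularImage f ⊂ regularImage f' ∧ y ∉ orbit G x ∧ f = collapse x y h * f' := by
  have hne : (regularImage f)ᶜ.Nonempty := by
    by_contra! hempty
    refine hf (isUnit_iff_surjective.2 fun y => ?_)
    obtain ⟨x, -, hx⟩ : y ∈ regularImage f := Set.compl_empty_iff.1 hempty ▸ Set.mem_univ y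
    exact ⟨x, hx⟩
  obtain ⟨w, hmin⟩ := (Set.toFinite _).exists_minimalFor (stabilizer G) _ hne
  have hw := notMem_range_of_minimalFor hmin
  obtain ⟨x, hxw, hx⟩ := exists_stabilizer_eq_of_notMem_range hw
  refine ⟨updateOrbit f x w hxw.le, w, f x, hxw.ge.trans (stabilizer_le_stabilizer_apply f x),
    regularImage_ssubset_regularImage_updateOrbit hw hxw hx, ?_, eq_collapse_mul_updateOrbit hw _ _⟩
  rintro ⟨g, hg⟩
  exact hw ⟨g⁻¹ • x, by rw [map_smul, inv_smul_eq_iff]; exact hg.symm⟩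

theorem eq_top_of_isUnit_mem_of_collapse_mem [Finite X] {S : Submonoid (X →[G] X)}
    (hunit : ∀ u, IsUnit u → u ∈ S)
    (hcollapse : ∀ (x y : X) (h : stabilizer G x ≤ stabilizer G y),
      y ∉ orbit G x → collapse x y h ∈ S) : S = ⊤ := by
  refine (Submonoid.eq_top_iff' S).2 fun f => ?_
  induction hI : regularImage f using WellFoundedGT.induction generalizing f with
  | ind I ih =>
    subst hI
    by_cases hf : IsUnit f
    · exact hunit f hf
    obtain ⟨f', x, y, h, hlt, hyx, rfl⟩ := exists_eq_collapse_mul_of_not_isUnit hf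
    exact S.mul_mem (hcollapse x y h hyx) (ih _ hlt f' rfl)

variable (G X) in
/-- The pairs `(H, K)` of stabilisers for which some `collapse x y` moves an orbit through a point
with stabiliser `H` onto a different orbit through a point with stabiliser `K`. -/
def collapseTypes : Set (Subgroup G × Subgroup G) :=
  {p | ∃ x y : X, y ∉ orbit G x ∧ stabilizer G x ≤ stabilizer G y ∧
    (stabilizer G x, stabilizer G y) = p}

theorem finite_collapseTypes [Finite X] : (collapseTypes G X).Finite :=
  (Set.finite_range fun p : X × X => (stabilizer G p.1, stabilizer G p.2)).subset <| by
    rintro _ ⟨x, y, -, -, rfl⟩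
    exact ⟨(x, y), rfl⟩

theorem exists_ncard_le_closure_isUnit_union_eq_top [Finite X] :
    ∃ V : Set (X →[G] X), V.ncard ≤ (collapseTypes G X).ncard ∧
      Submonoid.closure ({u | IsUnit u} ∪ V) = ⊤ := by
  have hex : ∀ p ∈ collapseTypes G X, ∃ c : X →[G] X, ∃ (x y : X)
      (h : stabilizer G x ≤ stabilizer G y), y ∉ orbit G x ∧
        (stabilizer G x, stabilizer G y) = p ∧ c = collapse x y h := by
    rintro p ⟨x, y, hyx, h, hp⟩
    exact ⟨_, x, y, h, hyx, hp, rfl⟩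
  choose! c hc using hex
  refine ⟨c '' collapseTypes G X, Set.ncard_image_le finite_collapseTypes, ?_⟩
  have hunit : ∀ u : X →[G] X, IsUnit u → u ∈ Submonoid.closure
      ({u | IsUnit u} ∪ c '' collapseTypes G X) := fun u hu =>
    Submonoid.subset_closure (.inl hu)
  refine eq_top_of_isUnit_mem_of_collapse_mem hunit fun x y h hyx => ?_
  have hp : (stabilizer G x, stabilizer G y) ∈ collapseTypes G X := ⟨x, y, hyx, h, rfl⟩
  obtain ⟨x', y', h', hyx', hstab, hcp⟩ := hc _ hp
  obtain ⟨hx, hy⟩ := Prod.ext_iff.1 hstab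
  refine collapse_mem_of_stabilizer_eq hunit hx.symm hy.symm hyx hyx' (h' := h') ?_
  exact Submonoid.subset_closure (.inr ⟨_, hp, hcp⟩)

/-- The unordered pairs of stabilisers of points lying in different orbits that `f` identifies. -/
def collisionTypes (f : X →[G] Y) : Set (Sym2 (Subgroup G)) :=
  {t | ∃ a b, b ∉ orbit G a ∧ f a = f b ∧ t = s(stabilizer G a, stabilizer G b)}

/-- An equivariant self-map separating the orbits permutes them, since they are finite in number,
and so it is surjective. -/
theorem isUnit_of_collisionTypes_eq_empty [Finite X] {f : X →[G] X}
    (hf : collisionTypes f = ∅) : IsUnit f := by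
  let φ : orbitRel.Quotient G X → orbitRel.Quotient G X :=
    Quotient.map f fun _ _ h => apply_mem_orbit f h
  have hφ : Function.Injective φ := by
    rintro ⟨a⟩ ⟨b⟩ hab
    obtain ⟨g, hg⟩ : f a ∈ orbit G (f b) := Quotient.exact hab
    refine Quotient.sound ?_
    change a ∈ orbit G b
    by_contra ha
    have : s(stabilizer G (g • b), stabilizer G a) ∈ collisionTypes f :=
      ⟨g • b, a, by rwa [orbit_smul], (map_smul f g b).trans hg, rfl⟩
    exact Set.notMem_empty _ (hf ▸ this)
  refine isUnit_iff_surjective.2 fun y => ?_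
  obtain ⟨⟨x⟩, hx⟩ := Finite.surjective_of_injective hφ ⟦y⟧
  obtain ⟨g, hg⟩ : y ∈ orbit G (f x) := Quotient.exact hx.symm
  exact ⟨g • x, (map_smul f g x).trans hg⟩

theorem collisionTypes_nonempty_iff [Finite X] {f : X →[G] X} :
    (collisionTypes f).Nonempty ↔ ¬IsUnit f := by
  refine ⟨?_, fun hf => Set.nonempty_iff_ne_empty.2 (mt isUnit_of_collisionTypes_eq_empty hf)⟩
  rintro ⟨_, a, b, hba, hab, rfl⟩ hf
  exact hba (isUnit_iff_injective.1 hf hab ▸ mem_orbit_self a)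

theorem collisionTypes_subset_mul_left (g f : X →[G] X) :
    collisionTypes f ⊆ collisionTypes (g * f) := by
  rintro _ ⟨a, b, hba, hab, rfl⟩
  exact ⟨a, b, hba, congrArg g hab, rfl⟩

theorem collisionTypes_subset_mul_right (f : X →[G] X) {u : X →[G] X} (hu : IsUnit u) :
    collisionTypes f ⊆ collisionTypes (f * u) := by
  have hu := isUnit_iff_bijective.1 hu
  rintro _ ⟨a, b, hba, hab, rfl⟩
  obtain ⟨a, rfl⟩ := hu.2 a
  obtain ⟨b, rfl⟩ := hu.2 b
  refine ⟨a, b, mt (apply_mem_orbit u) hba, hab, ?_⟩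
  simp only [stabilizer_apply_of_injective hu.1]

end Group

section CommGroup

variable {G X : Type*} [CommGroup G] [MulAction G X]

theorem stabilizer_eq_of_mem_orbit {x y : X} (h : y ∈ orbit G x) :
    stabilizer G y = stabilizer G x := by
  obtain ⟨g, rfl⟩ := h
  exact stabilizer_smul_eq_right g x

theorem collisionTypes_collapse {x y : X} {h : stabilizer G x ≤ stabilizer G y}
    (hyx : y ∉ orbit G x) :
    collisionTypes (collapse x y h) = {s(stabilizer G x, stabilizer G y)} := by
  refine subset_antisymm ?_ (Set.singleton_subset_iff.2
    ⟨x, y, hyx, by rw [collapse_self, collapse_of_notMem hyx], rfl⟩)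
  rintro _ ⟨a, b, hba, hab, rfl⟩
  by_cases ha : a ∈ orbit G x <;> by_cases hb : b ∈ orbit G x
  · exact absurd (orbit_eq_iff.2 ha ▸ hb) hba
  · obtain ⟨g, rfl⟩ := ha
    rw [map_smul, collapse_self, collapse_of_notMem hb] at hab
    simp only [← hab, stabilizer_smul_eq_right, Set.mem_singleton_iff]
  · obtain ⟨g, rfl⟩ := hb
    rw [map_smul, collapse_self, collapse_of_notMem ha] at hab
    simp only [hab, stabilizer_smul_eq_right, Set.mem_singleton_iff, Sym2.eq_swap]
  · rw [collapse_of_notMem ha, collapse_of_notMem hb] at hab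
    exact absurd (hab ▸ mem_orbit_self a) hba

theorem exists_mem_collisionTypes_eq [Finite X] {V : Set (X →[G] X)}
    (hV : Submonoid.closure ({u | IsUnit u} ∪ V) = ⊤) {x y : X} (hyx : y ∉ orbit G x)
    (h : stabilizer G x ≤ stabilizer G y) :
    ∃ v ∈ V, collisionTypes v = {s(stabilizer G x, stabilizer G y)} := by
  have hcollapse : ¬IsUnit (collapse x y h) := by
    rw [← collisionTypes_nonempty_iff, collisionTypes_collapse hyx]
    exact Set.singleton_nonempty _
  have hmem : collapse x y h ∈ Submonoid.closure ({u | IsUnit u} ∪ V) := hV ▸ Submonoid.mem_top _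
  obtain ⟨a, v, hv, u, hv', hu, hfac⟩ :=
    (isUnit_or_exists_eq_mul_mul_of_mem_closure hmem).resolve_left hcollapse
  refine ⟨v, hv, (Set.Nonempty.subset_singleton_iff (collisionTypes_nonempty_iff.2 hv')).1 ?_⟩
  calc collisionTypes v
    _ ⊆ collisionTypes (a * v) := collisionTypes_subset_mul_left a v
    _ ⊆ collisionTypes (a * v * u) := collisionTypes_subset_mul_right (a * v) hu
    _ = {s(stabilizer G x, stabilizer G y)} := by rw [← hfac, collisionTypes_collapse hyx]

theorem ncard_collapseTypes_le [Finite X] {V : Set (X →[G] X)}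
    (hV : Submonoid.closure ({u | IsUnit u} ∪ V) = ⊤) : (collapseTypes G X).ncard ≤ V.ncard := by
  have hex : ∀ p ∈ collapseTypes G X, ∃ v ∈ V, collisionTypes v = {s(p.1, p.2)} := by
    rintro _ ⟨x, y, hyx, h, rfl⟩
    exact exists_mem_collisionTypes_eq hV hyx h
  choose! v hvV hv using hex
  refine Set.ncard_le_ncard_of_injOn v hvV (fun p hp q hq hpq => ?_) V.toFinite
  have hsym : s(p.1, p.2) = s(q.1, q.2) := by
    rw [← Set.singleton_eq_singleton_iff, ← hv p hp, ← hv q hq, hpq]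
  obtain ⟨x, y, -, hle, rfl⟩ := hp
  obtain ⟨x', y', -, hle', rfl⟩ := hq
  obtain ⟨hx, hy⟩ | ⟨hxy, hyx⟩ := Sym2.eq_iff.1 hsym
  · exact Prod.ext hx hy
  · have heq : stabilizer G x = stabilizer G y :=
      hle.antisymm (hyx.trans_le (hle'.trans_eq hxy.symm))
    exact Prod.ext (heq.trans hyx) (heq.symm.trans hxy)

theorem relativeRank_isUnit [Finite X] :
    relativeRank {u : X →[G] X | IsUnit u} = (collapseTypes G X).ncard := by
  obtain ⟨⟨V, hVcard, hV⟩, hmin⟩ := relativeRank_isLeast {u : X →[G] X | IsUnit u}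
  obtain ⟨W, hWcard, hW⟩ := exists_ncard_le_closure_isUnit_union_eq_top (G := G) (X := X)
  exact le_antisymm ((hmin ⟨W, rfl, hW⟩).trans hWcard) (hVcard ▸ ncard_collapseTypes_le hV)

end CommGroup

end EquivariantEnd

namespace CellAut

open EquivariantEnd
open MulAction (stabilizer mem_stabilizer_iff mem_orbit_self orbit_eq_iff)

attribute [local instance] MulActionHom.End.instMonoidId

section Group

variable {G A : Type*} [Group G]

/-- The shift as a left action, `g • x = x · g⁻¹`, so that the library's group actions apply. It has
the same stabilisers and orbits as the right action. -/
abbrev shiftAction : MulAction G (G → A) where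
  smul g x := shift x g⁻¹
  one_smul x := by
    change shift x 1⁻¹ = x
    rw [inv_one, shift_one]
  mul_smul g k x := by
    change shift x (g * k)⁻¹ = shift (shift x k⁻¹) g⁻¹
    rw [mul_inv_rev, shift_mul]

attribute [local instance] shiftAction

theorem smul_apply (g : G) (x : G → A) (h : G) : (g • x) h = x (h * g) :=
  congrArg (fun k => x (h * k)) (inv_inv g)

theorem stabiliser_eq_stabilizer (x : G → A) : stabiliser x = stabilizer G x :=
  Subgroup.ext fun _ => (inv_mem_iff (H := stabiliser x)).symm

theorem orbit_eq_mulAction_orbit (x : G → A) : orbit x = MulAction.orbit G x := by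
  ext y
  refine ⟨?_, ?_⟩
  · rintro ⟨g, rfl⟩
    exact ⟨g⁻¹, congrArg (shift x) (inv_inv g)⟩
  · rintro ⟨g, rfl⟩
    exact ⟨g⁻¹, rfl⟩

theorem isCA_iff_map_smul [Finite G] {f : (G → A) → (G → A)} :
    IsCA f ↔ ∀ (g : G) (x : G → A), f (g • x) = g • f x := by
  refine ⟨?_, fun hf => ?_⟩
  · rintro ⟨S, μ, hμ⟩ g x
    funext h
    simp only [hμ, smul_apply, mul_assoc]
  · have := Fintype.ofFinite G
    refine ⟨Finset.univ, fun y => f (fun h => y ⟨h, Finset.mem_univ h⟩) 1, fun x g => ?_⟩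
    calc f x g
      _ = (g • f x) 1 := by rw [smul_apply, one_mul]
      _ = f (g • x) 1 := by rw [hf]
      _ = f (fun h => x (h * g)) 1 := by simp only [← smul_apply]

/-- Over a finite group every equivariant self-map of `A^G` is a cellular automaton, with memory set
the whole group. -/
def caEquiv [Finite G] : CA G A ≃* ((G → A) →[G] (G → A)) where
  toFun τ := ⟨τ.1, isCA_iff_map_smul.1 τ.2⟩
  invFun f := ⟨fun x => f x, isCA_iff_map_smul.2 fun g x => map_smul f g x⟩
  map_mul' _ _ := rfl

theorem mem_ICA_iff_isUnit {τ : CA G A} : τ ∈ ICA G A ↔ IsUnit τ :=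
  isUnit_iff_exists.symm

theorem caEquiv_image_ICA [Finite G] : caEquiv '' ICA G A = {u | IsUnit u} := by
  ext u
  obtain ⟨τ, rfl⟩ := (caEquiv (G := G) (A := A)).surjective u
  rw [caEquiv.injective.mem_set_image, mem_ICA_iff_isUnit]
  exact (MulEquiv.isUnit_map caEquiv).symm

theorem exists_stabilizer_eq [Nontrivial A] (H : Subgroup G) :
    ∃ x : G → A, stabilizer G x = H := by
  classical
  obtain ⟨a, b, hab⟩ := exists_pair_ne A
  refine ⟨fun g => if g ∈ H then a else b, ?_⟩
  ext g
  rw [mem_stabilizer_iff]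
  refine ⟨fun hg => ?_, fun hg => ?_⟩
  · by_contra hgH
    have hone := congrFun hg 1
    rw [smul_apply, one_mul, if_neg hgH, if_pos H.one_mem] at hone
    exact hab hone.symm
  · funext h
    simp only [smul_apply, H.mul_mem_cancel_right hg]

end Group

section CommGroup

variable {G A : Type*} [CommGroup G]

attribute [local instance] shiftAction

theorem relativeRank_ICA [Finite G] [Finite A] :
    relativeRank (ICA G A) = (collapseTypes G (G → A)).ncard := by
  rw [← relativeRank_image_mulEquiv caEquiv, caEquiv_image_ICA, relativeRank_isUnit]

theorem conjBy_eq_self (H : Subgroup G) (g : G) : conjBy H g = H := by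
  ext k
  rw [mem_conjBy, mul_inv_cancel_comm]

theorem conjClass_injective : Function.Injective (conjClass : Subgroup G → ConjClass G) := by
  intro H K h
  obtain ⟨g, rfl⟩ := Quotient.exact h
  exact (conjBy_eq_self H g).symm

theorem edges_eq_image :
    edges G = Prod.map conjClass conjClass '' {p : Subgroup G × Subgroup G | p.1 ≤ p.2} := by
  ext ⟨c, d⟩
  refine ⟨?_, ?_⟩
  · rintro ⟨H, K, rfl, rfl, g, hle⟩
    exact ⟨(H, K), hle.trans_eq (conjBy_eq_self K g), rfl⟩
  · rintro ⟨⟨H, K⟩, hle, hcd⟩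
    obtain ⟨rfl, rfl⟩ := Prod.ext_iff.1 hcd
    exact ⟨H, K, rfl, rfl, 1, hle.trans_eq (conjBy_eq_self K 1).symm⟩

theorem ncard_edges : (edges G).ncard = {p : Subgroup G × Subgroup G | p.1 ≤ p.2}.ncard := by
  rw [edges_eq_image,
    Set.ncard_image_of_injective _ (conjClass_injective.prodMap conjClass_injective)]

theorem mem_box_iff {H : Subgroup G} {x : G → A} : x ∈ box H A ↔ stabilizer G x = H := by
  rw [← stabiliser_eq_stabilizer]
  exact conjClass_injective.eq_iff

theorem orbit_subset_box_iff {H : Subgroup G} {x : G → A} :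
    orbit x ⊆ box H A ↔ stabilizer G x = H := by
  rw [orbit_eq_mulAction_orbit]
  refine ⟨fun h => mem_box_iff.1 (h (mem_orbit_self x)), fun h y hy => mem_box_iff.2 ?_⟩
  rw [stabilizer_eq_of_mem_orbit hy, h]

theorem alpha_eq_one_iff [Nontrivial A] {H : Subgroup G} :
    alpha H A = 1 ↔ ∀ x y : G → A,
      stabilizer G x = H → stabilizer G y = H → y ∈ MulAction.orbit G x := by
  rw [alpha, Set.ncard_eq_one]
  refine ⟨?_, fun h => ?_⟩
  · rintro ⟨O, hO⟩ x y hx hy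
    have horbit : ∀ z, stabilizer G z = H → orbit z = O := fun z hz =>
      Set.mem_singleton_iff.1 (hO ▸ ⟨⟨z, rfl⟩, orbit_subset_box_iff.2 hz⟩)
    rw [← orbit_eq_iff, ← orbit_eq_mulAction_orbit, ← orbit_eq_mulAction_orbit, horbit x hx,
      horbit y hy]
  · obtain ⟨x, hx⟩ := exists_stabilizer_eq (A := A) H
    refine ⟨orbit x, Set.eq_singleton_iff_unique_mem.2
      ⟨⟨⟨x, rfl⟩, orbit_subset_box_iff.2 hx⟩, ?_⟩⟩
    rintro _ ⟨⟨y, rfl⟩, hy⟩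
    rw [orbit_eq_mulAction_orbit, orbit_eq_mulAction_orbit, orbit_eq_iff]
    exact h x y hx (orbit_subset_box_iff.1 hy)

theorem alpha_top_ne_one [Nontrivial A] : alpha (⊤ : Subgroup G) A ≠ 1 := by
  obtain ⟨a, b, hab⟩ := exists_pair_ne A
  have hconst : ∀ c : A, stabilizer G (fun _ : G => c) = ⊤ := fun c => eq_top_iff.2 fun _ _ => rfl
  intro h
  obtain ⟨g, hg⟩ := alpha_eq_one_iff.1 h _ _ (hconst a) (hconst b)
  exact hab (congrFun hg 1)

theorem collapseTypes_eq_sdiff [Nontrivial A] :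
    collapseTypes G (G → A) = {p | p.1 ≤ p.2} \ (fun H => (H, H)) '' {H | alpha H A = 1} := by
  ext ⟨H, K⟩
  refine ⟨?_, ?_⟩
  · rintro ⟨x, y, hyx, hle, hstab⟩
    obtain ⟨rfl, rfl⟩ := Prod.ext_iff.1 hstab
    refine ⟨hle, ?_⟩
    rintro ⟨L, hL, hdiag⟩
    obtain ⟨hx, hy⟩ := Prod.ext_iff.1 hdiag
    exact hyx (alpha_eq_one_iff.1 hL x y hx.symm hy.symm)
  · rintro ⟨hle, hdiag⟩
    obtain rfl | hne := eq_or_ne H K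
    · have hH : ¬alpha H A = 1 := fun h => hdiag ⟨H, h, rfl⟩
      rw [alpha_eq_one_iff] at hH
      push Not at hH
      obtain ⟨x, y, hx, hy, hyx⟩ := hH
      exact ⟨x, y, hyx, (hx.trans hy.symm).le, Prod.ext hx hy⟩
    · obtain ⟨x, rfl⟩ := exists_stabilizer_eq (A := A) H
      obtain ⟨y, rfl⟩ := exists_stabilizer_eq (A := A) K
      exact ⟨x, y, fun h => hne (stabilizer_eq_of_mem_orbit h).symm, hle, rfl⟩

theorem relativeRank_ICA_add_ncard_alpha_eq_one [Finite G] [Finite A] [Nontrivial A] :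
    relativeRank (ICA G A) + {H : Subgroup G | alpha H A = 1}.ncard = (edges G).ncard := by
  have hdiag : Function.Injective fun H : Subgroup G => (H, H) := fun _ _ h =>
    (Prod.ext_iff.1 h).1
  rw [relativeRank_ICA, collapseTypes_eq_sdiff, ncard_edges, ← Set.ncard_image_of_injective _ hdiag]
  refine Set.ncard_sdiff_add_ncard_of_subset ?_
  rintro _ ⟨H, -, rfl⟩
  exact le_refl H

end CommGroup

theorem sum_kronecker_eq_ncard {ι β : Type*} [Fintype ι] {f : ι → β} (hf : Function.Bijective f)
    (φ : β → ℕ) (c : ℕ) : ∑ i, kronecker (φ (f i)) c = {b | φ b = c}.ncard := by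
  classical
  calc ∑ i, kronecker (φ (f i)) c
    _ = {i | φ (f i) = c}.ncard := by
      simp only [kronecker, Finset.sum_boole, Nat.cast_id, Set.ncard_eq_toFinset_card',
        Set.toFinset_ofPred]
    _ = (f '' {i | φ (f i) = c}).ncard := (Set.ncard_image_of_injective _ hf.injective).symm
    _ = {b | φ b = c}.ncard :=
      congrArg Set.ncard (Set.image_preimage_eq {b | φ b = c} hf.surjective)

end CellAut

theorem mainTheorem1 {G A : Type*} [CommGroup G] [Finite G] [Finite A] (hA : 2 ≤ Nat.card A)
    (r : ℕ) [NeZero r] (H : Fin r → Subgroup G) (hH : Function.Bijective H) (hH1 : H 0 = ⊤) :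
    (CellAut.relativeRank (CellAut.ICA G A) : ℤ) =
      ((CellAut.edges G).ncard : ℤ) -
        ∑ i ∈ Finset.univ.erase (0 : Fin r),
          (CellAut.kronecker (CellAut.alpha (H i) A) 1 : ℤ) := by
  open CellAut in
  have : Nontrivial A := Finite.one_lt_card_iff_nontrivial.1 hA
  have htop : kronecker (alpha (H 0) A) 1 = 0 := by
    rw [hH1]
    exact if_neg alpha_top_ne_one
  have hsum : ∑ i ∈ Finset.univ.erase (0 : Fin r), kronecker (alpha (H i) A) 1 =
      {K : Subgroup G | alpha K A = 1}.ncard :=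
    (Finset.sum_erase (f := fun i => kronecker (alpha (H i) A) 1) _ htop).trans
      (sum_kronecker_eq_ncard hH (alpha · A) 1)
  rw [eq_sub_iff_add_eq, ← relativeRank_ICA_add_ncard_alpha_eq_one (A := A), ← hsum]
  push_cast
  rfl
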